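/- All rings are commutative with $1$, and a local ring is a Noetherian ring with exactly one maximal ideal. Let $(R,M)$ be a local ring with $\dim R\ge 2$, let $T=\varprojlim_k R/M^k$ be its $M$-adic completion, and let $P_1,\dots,P_n$ ($n\ge 1$) be pairwise incomparable prime ideals of $R$ (that is, $P_i\not\subseteq P_j$ for $i\ne j$). Then there exists a local ring $(S,N)$, namely the completion $S=\varprojlim_k R/I^k$ of $R$ at $I=P_1\cap\dots\cap P_n$, with the following properties. 1. $S$ is a faithfully flat local extension ring of $R$: the map $R\to S$ is an injective local homomorphism and is faithfully flat. 2. The $N$-adic completion of $S$ is isomorphic to $T$ as an $R$-algebra. 3. $S/P_iS\cong R/P_i$ as $R$-algebras for every $i$. 4. For every chain $Q_1\subsetneq Q_2\subsetneq Q_3$ of prime ideals of $S$ such that $P_iS\not\subseteq Q_1$ for all $i$, the set of prime ideals $Q'$ of $S$ with $Q_1\subsetneq Q'\subsetneq Q_3$ has cardinality exactly $|\operatorname{Spec}(T)|$. 5. For every $i$, if $|\operatorname{Spec}(R/P_i)|<|\operatorname{Spec}(T)|$, then $|\operatorname{Spec}(S/P_iS)|<|\operatorname{Spec}(T)|$.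 -/

import Mathlib

universe u

open IsLocalRing Cardinal

namespace AdicCompletion

/-! ### Completion at a finitely generated ideal -/

section General

variable {R : Type*} [CommRing R] (I : Ideal R)

/-! Since `I ≤ P i ≤ M` and `R/I ^ n = S/I ^ n S`, completing at `I` changes neither `R/P i` nor
`R/M ^ n`; so `S` and `R` have the same completion `T`, and the claims on `S/P i S` follow.

For the count of primes, `Spec T → Spec S` is onto by faithful flatness, so `|Spec T|` is an upper
bound. Conversely, with `k` the residue field, `|Spec T| ≤ |k^ℕ|` because `T` is Noetherian. It
remains to find `|k^ℕ|` primes between `Q₁` and `Q₃`. As `IS` is not inside `Q₁`, pick `a` in `IS`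
outside `Q₁`; power series in `a` with coefficients lifted from `k` converge, and two of them differ
by a power of `a` times a unit. In the domain `S/Q₁`, primes minimal over `x + a * y * t`, for
suitable `x`, `y` and varying such `t`, are pairwise distinct
(`exists_injective_prime_between_of_isDomain`). -/

lemma ker_evalₐ_eq_map_pow (hI : I.FG) (n : ℕ) :
    RingHom.ker (evalₐ I n) = (I ^ n).map (algebraMap R (AdicCompletion I R)) := by
  ext x
  have h1 : x ∈ (I ^ n).map (algebraMap R (AdicCompletion I R)) ↔ x ∈ (eval I R n).ker := by
    rw [← pow_smul_top_eq_ker_eval hI, Ideal.smul_top_eq_map]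
    rfl
  rw [h1, RingHom.mem_ker, LinearMap.mem_ker]
  constructor
  · intro h
    rw [← factor_evalₐ_eq_eval I x (by simp), h]; rfl
  · intro h
    rw [← factor_eval_eq_evalₐ I x (by simp), h]; rfl

lemma exists_sub_algebraMap_mem (hI : I.FG) (n : ℕ) (s : AdicCompletion I R) :
    ∃ r : R, s - algebraMap R _ r ∈ (I ^ n).map (algebraMap R (AdicCompletion I R)) := by
  obtain ⟨r, hr⟩ := Ideal.Quotient.mk_surjective (evalₐ I n s)
  refine ⟨r, ?_⟩
  rw [← ker_evalₐ_eq_map_pow I hI, RingHom.mem_ker, map_sub, AlgHom.commutes, ← hr, sub_eq_zero]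
  rfl

lemma _root_.MvPolynomial.idealOfVars_pow_le_comap_eval {σ : Type*} {a : σ → R}
    (ha : ∀ i, a i ∈ I) (n : ℕ) :
    MvPolynomial.idealOfVars σ R ^ n ≤ (I ^ n).comap (MvPolynomial.eval a) := by
  rw [← Ideal.map_le_iff_le_comap, Ideal.map_pow]
  refine Ideal.pow_right_mono ?_ n
  rw [MvPolynomial.idealOfVars, Ideal.map_span, Ideal.span_le]
  rintro _ ⟨_, ⟨i, rfl⟩, rfl⟩
  simpa using ha i

section Eval

variable {σ : Type*} [Finite σ] (a : σ → R) (ha : ∀ i, a i ∈ I)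

/-- Evaluation of power series at elements of `I`, modulo `I ^ n`. -/
noncomputable def mvPowerSeriesEvalQuotient (n : ℕ) : MvPowerSeries σ R →+* R ⧸ I ^ n :=
  (Ideal.quotientMap (I ^ n) (MvPolynomial.eval a)
    (MvPolynomial.idealOfVars_pow_le_comap_eval I ha n)).comp
    (MvPowerSeries.truncTotalAlgHom σ R n : _ →+* _)

lemma factorPow_comp_mvPowerSeriesEvalQuotient {m n : ℕ} (hmn : m ≤ n) :
    (Ideal.Quotient.factorPow I hmn).comp (mvPowerSeriesEvalQuotient I a ha n) =
      mvPowerSeriesEvalQuotient I a ha m := by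
  ext p
  have := MvPolynomial.idealOfVars_pow_le_comap_eval I ha m
    (MvPowerSeries.truncTotal_sub_truncTotal_mem_pow_idealOfVars hmn le_rfl p)
  rw [Ideal.mem_comap, map_sub] at this
  simpa [mvPowerSeriesEvalQuotient, Ideal.Quotient.mk_eq_mk_iff_sub_mem] using this

/-- Evaluation of power series at elements of `I`, with values in the `I`-adic completion. -/
noncomputable def mvPowerSeriesEval : MvPowerSeries σ R →+* AdicCompletion I R :=
  liftRingHom I (mvPowerSeriesEvalQuotient I a ha) (factorPow_comp_mvPowerSeriesEvalQuotient I a ha)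

lemma mvPowerSeriesEval_coe (p : MvPolynomial σ R) :
    mvPowerSeriesEval I a ha p = algebraMap R _ (p.eval a) := by
  refine ext_evalₐ fun n ↦ ?_
  rw [mvPowerSeriesEval,
    evalₐ_liftRingHom I _ (factorPow_comp_mvPowerSeriesEvalQuotient I a ha), AlgHom.commutes]
  exact congrArg (Ideal.quotientMap (I ^ n) (MvPolynomial.eval a)
    (MvPolynomial.idealOfVars_pow_le_comap_eval I ha n))
    ((MvPowerSeries.truncTotalAlgHom σ R n).commutes p)

end Eval

/-- Sending the variables to generators of `I` makes the completion a quotient of a power series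
ring over `R`: surjectivity modulo `I` lifts by completeness. -/
theorem isNoetherianRing [IsNoetherianRing R] : IsNoetherianRing (AdicCompletion I R) := by
  have hI : I.FG := IsNoetherian.noetherian I
  obtain ⟨n, a, ha⟩ := Submodule.fg_iff_exists_fin_generating_family.mp hI
  have ha' (i) : a i ∈ I := ha ▸ Submodule.subset_span ⟨i, rfl⟩
  let f := mvPowerSeriesEval I a ha'
  have hX (i) : f (MvPowerSeries.X i) = algebraMap R _ (a i) := by
    simpa [f] using mvPowerSeriesEval_coe I a ha' (MvPolynomial.X i)
  have hC (r) : f (MvPowerSeries.C r) = algebraMap R _ r := by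
    simpa [f] using mvPowerSeriesEval_coe I a ha' (MvPolynomial.C r)
  have hmap : (Ideal.span (Set.range MvPowerSeries.X)).map f =
      I.map (algebraMap R (AdicCompletion I R)) := by
    have ha : I = Ideal.span (Set.range a) := ha.symm
    conv_rhs => enter [2]; rw [ha]
    rw [Ideal.map_span, Ideal.map_span, ← Set.range_comp, ← Set.range_comp]
    congr 2
    exact funext hX
  have := isAdicComplete_self I hI
  have : IsHausdorff ((Ideal.span (Set.range MvPowerSeries.X)).map f) (AdicCompletion I R) := by
    rw [hmap]; infer_instance
  refine isNoetherianRing_of_surjective _ _ f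
    (surjective_of_mk_map_comp_surjective (I := Ideal.span (Set.range MvPowerSeries.X)) f ?_)
  intro y
  obtain ⟨s, rfl⟩ := Ideal.Quotient.mk_surjective y
  obtain ⟨r, hr⟩ := exists_sub_algebraMap_mem I hI 1 s
  refine ⟨MvPowerSeries.C r, ?_⟩
  rw [RingHom.comp_apply, hC, eq_comm, Ideal.Quotient.mk_eq_mk_iff_sub_mem, hmap]
  simpa using hr

/-- The kernel lies in the Jacobson radical, by completeness. -/
lemma isLocalHom_evalOneₐ (hI : I.FG) : IsLocalHom (evalOneₐ I).toRingHom := by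
  have := isAdicComplete_self I hI
  refine ⟨fun s hs ↦ ?_⟩
  obtain ⟨t, ht⟩ := evalOneₐ_surjective I (hs.unit⁻¹ : _)
  have h : s * t - 1 ∈ I.map (algebraMap R (AdicCompletion I R)) := by
    rw [← ker_evalOneₐ_eq_map I hI, RingHom.mem_ker, map_sub, map_mul, map_one]
    change _ * evalOneₐ I t - 1 = 0
    rw [ht, sub_eq_zero]
    exact hs.mul_val_inv
  have := Ideal.mem_jacobson_bot.mp (IsAdicComplete.le_jacobson_bot _ h) 1
  rw [mul_one, sub_add_cancel] at this
  exact isUnit_of_mul_isUnit_left this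

end General

/-! ### Completion of a local ring at a proper ideal -/

section Local

variable {R : Type*} [CommRing R] [IsLocalRing R] (I : Ideal R)

theorem isLocalRing_of_ne_top (hI : I.FG) (h : I ≠ ⊤) : IsLocalRing (AdicCompletion I R) := by
  have := Ideal.Quotient.nontrivial_iff.mpr h
  have := IsLocalRing.of_surjective' (Ideal.Quotient.mk I) Ideal.Quotient.mk_surjective
  have := isLocalHom_evalOneₐ I hI
  exact (evalOneₐ I).toRingHom.domain_isLocalRing

lemma isLocalHom_algebraMap (h : I ≠ ⊤) : IsLocalHom (algebraMap R (AdicCompletion I R)) := by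
  have := Ideal.Quotient.nontrivial_iff.mpr h
  refine ⟨fun r hr ↦ ?_⟩
  have h1 := hr.map (evalOneₐ I)
  rw [AlgHom.commutes] at h1
  have := IsLocalHom.of_surjective (Ideal.Quotient.mk I) Ideal.Quotient.mk_surjective
  exact isUnit_of_map_unit (Ideal.Quotient.mk I) r h1

lemma maximalIdeal_eq_map_of_ne_top (hI : I.FG) (h : I ≠ ⊤) [IsLocalRing (AdicCompletion I R)] :
    maximalIdeal (AdicCompletion I R) =
      (maximalIdeal R).map (algebraMap R (AdicCompletion I R)) :=
  (eq_maximalIdeal (isMaximal_map_of_le I _ (le_maximalIdeal h) hI)).symm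

theorem faithfullyFlat_of_ne_top [IsNoetherianRing R] (h : I ≠ ⊤) :
    Module.FaithfullyFlat R (AdicCompletion I R) := by
  have := isLocalRing_of_ne_top I (IsNoetherian.noetherian I) h
  have := isLocalHom_algebraMap I h
  exact Module.FaithfullyFlat.of_flat_of_isLocalHom

end Local

/-! ### Comparing quotients and completions -/

section Comparison

variable {A B : Type*} [CommRing A] [CommRing B] [Algebra A B]

/-- If `B` is faithfully flat over `A` and `B = A + 𝔞 B`, then `A ⧸ 𝔞 ≃ B ⧸ 𝔞 B`. -/
noncomputable def _root_.Ideal.quotientEquivOfFaithfullyFlat [Module.FaithfullyFlat A B]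
    (𝔞 : Ideal A) (𝔟 : Ideal B) (hab : 𝔟 = 𝔞.map (algebraMap A B))
    (h : ∀ b : B, ∃ a : A, b - algebraMap A B a ∈ 𝔟) : (A ⧸ 𝔞) ≃ₐ[A] (B ⧸ 𝔟) :=
  (Ideal.quotientEquivAlgOfEq A (by
    ext a
    rw [RingHom.mem_ker, Algebra.ofId_apply, ← Ideal.Quotient.mk_algebraMap,
      Ideal.Quotient.eq_zero_iff_mem, ← Ideal.mem_comap, hab,
      Ideal.comap_map_eq_self_of_faithfullyFlat])).trans
  (Ideal.quotientKerAlgEquivOfSurjective (f := Algebra.ofId A (B ⧸ 𝔟)) (by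
    intro y
    obtain ⟨b, rfl⟩ := Ideal.Quotient.mk_surjective y
    obtain ⟨a, ha⟩ := h b
    exact ⟨a, ((Ideal.Quotient.mk_eq_mk_iff_sub_mem _ _).mpr ha).symm⟩))

/-- Adic completions of `A` and `B` agree if all the quotients compatibly agree. -/
noncomputable def congrOfQuotientEquiv (I : Ideal A) (J : Ideal B)
    (e : ∀ n : ℕ, (A ⧸ I ^ n) ≃ₐ[A] (B ⧸ J ^ n)) (hsurj : ∀ n, ∀ b : B, ∃ a : A,
      b - algebraMap A B a ∈ J ^ n) : AdicCompletion J B ≃ₐ[A] AdicCompletion I A :=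
  have key (n : ℕ) (a : A) : (e n).symm (Ideal.Quotient.mk _ (algebraMap A B a)) =
      Ideal.Quotient.mk _ a := by
    rw [AlgEquiv.symm_apply_eq]
    exact ((e n).commutes a).symm
  have h1 {m n : ℕ} (hmn : m ≤ n) (y : B ⧸ J ^ n) :
      Ideal.Quotient.factor (Ideal.pow_le_pow_right hmn) ((e n).symm y) =
      (e m).symm (Ideal.Quotient.factor (Ideal.pow_le_pow_right hmn) y) := by
    obtain ⟨b, rfl⟩ := Ideal.Quotient.mk_surjective y
    obtain ⟨a, ha⟩ := hsurj n b
    rw [(Ideal.Quotient.mk_eq_mk_iff_sub_mem _ _).mpr ha, key, Ideal.Quotient.factor_mk,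
      Ideal.Quotient.factor_mk, key]
  have h2 {m n : ℕ} (hmn : m ≤ n) (y : A ⧸ I ^ n) :
      Ideal.Quotient.factor (Ideal.pow_le_pow_right hmn) (e n y) =
      e m (Ideal.Quotient.factor (Ideal.pow_le_pow_right hmn) y) := by
    rw [← AlgEquiv.symm_apply_eq, ← h1 hmn, AlgEquiv.symm_apply_apply]
  have t1 {m n : ℕ} (hmn : m ≤ n) (x : AdicCompletion J B) :
      Ideal.Quotient.factor (Ideal.pow_le_pow_right hmn) (evalₐ J n x) = evalₐ J m x := by
    obtain ⟨x, rfl⟩ := mk_surjective _ _ x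
    simp only [evalₐ_mk, Ideal.Quotient.factor_mk]
    exact Ideal.mk_eq_mk J hmn x
  have t2 {m n : ℕ} (hmn : m ≤ n) (x : AdicCompletion I A) :
      Ideal.Quotient.factor (Ideal.pow_le_pow_right hmn) (evalₐ I n x) = evalₐ I m x := by
    obtain ⟨x, rfl⟩ := mk_surjective _ _ x
    simp only [evalₐ_mk, Ideal.Quotient.factor_mk]
    exact Ideal.mk_eq_mk I hmn x
  AlgEquiv.ofAlgHom
    (liftAlgHom I (fun n ↦ (e n).symm.toAlgHom.comp ((evalₐ J n).restrictScalars A)) (by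
      intro m n hmn
      ext x
      exact (h1 hmn _).trans (congrArg _ (t1 hmn x))))
    (liftAlgHom J (fun n ↦ (e n).toAlgHom.comp (evalₐ I n)) (by
      intro m n hmn
      ext x
      exact (h2 hmn _).trans (congrArg _ (t2 hmn x))))
    (by
      refine AlgHom.ext fun x ↦ ext_evalₐ fun n ↦ ?_
      simp)
    (by
      refine AlgHom.ext fun x ↦ ext_evalₐ fun n ↦ ?_
      simp)

end Comparison

end AdicCompletion

/-! ### Many primes below a prime of height at least two -/

namespace Ideal

lemma eq_bot_of_lt_of_mem_minimalPrimes_span_singleton {D : Type*} [CommRing D] [IsDomain D]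
    [IsNoetherianRing D] {x : D} {p q : Ideal D} (hp : p ∈ (span {x}).minimalPrimes)
    [q.IsPrime] (hq : q < p) : q = ⊥ := by
  have := hp.1.1
  have h := height_le_one_of_isPrincipal_of_mem_minimalPrimes _ p hp
  have := (height_le_iff (n := 1)).mp (by exact_mod_cast h) q inferInstance hq
  rw [← height_eq_zero_iff_eq_bot]
  exact Order.lt_one_iff.mp (by exact_mod_cast this)

/-- In a Noetherian domain, a prime of height at least two contains at least as many nonzero
primes as a family of elements whose differences divide powers of a fixed element. -/
theorem exists_injective_prime_between_of_isDomain {D : Type*} [CommRing D] [IsDomain D]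
    [IsNoetherianRing D] {Q' Q : Ideal D} [Q'.IsPrime] [Q.IsPrime] (hbot : Q' ≠ ⊥) (hlt : Q' < Q)
    {ι : Type*} {a : D} (ha : a ≠ 0) (t : ι → D)
    (ht : ∀ i j, i ≠ j → ∃ n, t i - t j ∣ a ^ n) :
    ∃ f : ι → Ideal D, Function.Injective f ∧ ∀ i, (f i).IsPrime ∧ ⊥ < f i ∧ f i < Q := by
  -- The element `a` may lie outside `Q`; the factor `y` keeps every `x + a * y * t i` inside `Q`.
  obtain ⟨y, hyQ', hy0⟩ := Submodule.exists_mem_ne_zero_of_ne_bot hbot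
  have hyQ := hlt.le hyQ'
  have hay : a * y ≠ 0 := mul_ne_zero ha hy0
  -- Prime avoidance: the finitely many minimal primes of `a * y` have height at most one, so none
  -- contains `Q`.
  obtain ⟨x, hxQ, hx⟩ : ∃ x ∈ Q, ∀ p ∈ (span {a * y}).minimalPrimes, x ∉ p := by
    by_contra! hcon
    have hsub : (Q : Set D) ⊆ ⋃ p ∈ (span {a * y}).minimalPrimes, (p : Set D) := by
      intro x hx
      simpa using hcon x hx
    obtain ⟨p, hp, hQp⟩ := (subset_union_prime_finite (f := id)
      (finite_minimalPrimes_of_isNoetherianRing D (span {a * y})) ⊥ ⊥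
      (fun p hp _ _ ↦ hp.1.1)).mp hsub
    exact hbot (eq_bot_of_lt_of_mem_minimalPrimes_span_singleton hp (hlt.trans_le hQp))
  have hne (i : ι) : x + a * y * t i ≠ 0 := by
    intro h
    obtain ⟨p, hp, -⟩ := exists_minimalPrimes_le
      ((span_singleton_le_iff_mem Q).mpr (Q.mul_mem_left a hyQ))
    refine hx p hp ?_
    rw [eq_neg_of_add_eq_zero_left h]
    exact p.neg_mem (p.mul_mem_right _ (hp.1.2 (mem_span_singleton_self _)))
  have hmem (i : ι) : x + a * y * t i ∈ Q :=
    Q.add_mem hxQ (Q.mul_mem_right _ (Q.mul_mem_left _ hyQ))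
  choose f hf hfQ using fun i ↦ exists_minimalPrimes_le ((span_singleton_le_iff_mem Q).mpr (hmem i))
  have hzf (i : ι) : x + a * y * t i ∈ f i := (hf i).1.2 (mem_span_singleton_self _)
  refine ⟨f, fun i j hij ↦ ?_, fun i ↦ ⟨(hf i).1.1, bot_lt_iff_ne_bot.mpr fun h ↦ hne i ?_,
    lt_of_le_of_ne (hfQ i) fun h ↦ hbot ?_⟩⟩
  · by_contra hne'
    obtain ⟨n, c, hn⟩ := ht i j hne'
    have := (hf i).1.1
    have h1 : a * y * (t i - t j) ∈ f i := by
      have := (f i).sub_mem (hzf i) (hij ▸ hzf j)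
      convert this using 1
      ring
    have h2 : (a * y) * a ^ n ∈ f i := by
      rw [hn, ← mul_assoc]
      exact (f i).mul_mem_right _ h1
    have h3 : a * y ∈ f i := by
      rcases this.mem_or_mem h2 with h | h
      · exact h
      · exact (f i).mul_mem_right _ (this.mem_of_pow_mem _ h)
    have h4 : x ∈ f i := by
      have := (f i).sub_mem (hzf i) ((f i).mul_mem_right (t i) h3)
      simpa using this
    -- Having height at most one, `f i` is itself minimal over `a * y`, yet it contains `x`.
    obtain ⟨p, hp, hpf⟩ := exists_minimalPrimes_le ((span_singleton_le_iff_mem (f i)).mpr h3)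
    have := hp.1.1
    rcases hpf.lt_or_eq with hlt | heq
    · have := eq_bot_of_lt_of_mem_minimalPrimes_span_singleton (hf i) hlt
      have h5 := hp.1.2 (mem_span_singleton_self (a * y))
      rw [this] at h5
      exact hay h5
    · exact hx p hp (heq ▸ h4)
  · simpa [h] using hzf i
  · exact eq_bot_of_lt_of_mem_minimalPrimes_span_singleton (hf i) (h ▸ hlt)

theorem exists_injective_primeSpectrum_between {A : Type*} [CommRing A] [IsNoetherianRing A]
    {Q₁ Q₂ Q₃ : PrimeSpectrum A} (h₁₂ : Q₁ < Q₂) (h₂₃ : Q₂ < Q₃) {ι : Type*} {a : A}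
    (ha : a ∉ Q₁.asIdeal) (t : ι → A) (ht : ∀ i j, i ≠ j → ∃ n, t i - t j ∣ a ^ n) :
    ∃ f : ι → {Q : PrimeSpectrum A // Q₁ < Q ∧ Q < Q₃}, Function.Injective f := by
  let π := Quotient.mk Q₁.asIdeal
  have hπ : Function.Surjective π := Quotient.mk_surjective
  have hprime (Q : PrimeSpectrum A) (hQ : Q₁ < Q) : (Q.asIdeal.map π).IsPrime :=
    map_isPrime_of_surjective hπ (by rw [mk_ker]; exact hQ.le)
  have hcomap (Q : PrimeSpectrum A) (hQ : Q₁ < Q) : (Q.asIdeal.map π).comap π = Q.asIdeal := by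
    rw [comap_map_of_surjective' π hπ, mk_ker, sup_eq_left]
    exact hQ.le
  have := hprime Q₂ h₁₂
  have := hprime Q₃ (h₁₂.trans h₂₃)
  have hlt : Q₂.asIdeal.map π < Q₃.asIdeal.map π := by
    refine lt_of_le_of_ne (map_mono h₂₃.le) fun h ↦ h₂₃.ne (PrimeSpectrum.ext ?_)
    rw [← hcomap Q₂ h₁₂, h, hcomap Q₃ (h₁₂.trans h₂₃)]
  have hbot : Q₂.asIdeal.map π ≠ ⊥ := by
    intro h
    refine h₁₂.ne (PrimeSpectrum.ext ?_)
    rw [← hcomap Q₂ h₁₂, h, ← RingHom.ker_eq_comap_bot, mk_ker]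
  obtain ⟨f, hf, hf'⟩ := exists_injective_prime_between_of_isDomain hbot hlt (a := π a)
    (by rwa [Ne, Quotient.eq_zero_iff_mem]) (fun i ↦ π (t i)) (by
      intro i j hij
      obtain ⟨n, hn⟩ := ht i j hij
      exact ⟨n, by simpa using map_dvd π hn⟩)
  have hstrict {p q : Ideal (A ⧸ Q₁.asIdeal)} (h : p < q) : p.comap π < q.comap π :=
    lt_of_le_of_ne (comap_mono h.le) fun h' ↦ h.ne (comap_injective_of_surjective π hπ h')
  refine ⟨fun i ↦ ⟨⟨(f i).comap π, have := (hf' i).1; inferInstance⟩, ?_, ?_⟩, ?_⟩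
  · have := hstrict (hf' i).2.1
    rw [← RingHom.ker_eq_comap_bot, mk_ker] at this
    exact this
  · have := hstrict (hf' i).2.2
    rw [hcomap Q₃ (h₁₂.trans h₂₃)] at this
    exact this
  · intro i j hij
    exact hf (comap_injective_of_surjective π hπ (congrArg (fun Q ↦ Q.1.asIdeal) hij))

end Ideal

/-! ### Power series in a complete ring -/

section

variable {A : Type*} [CommRing A] (I : Ideal A) [IsAdicComplete I A]

/-- Power series in an element `a` of `I` can be evaluated in an `I`-adically complete ring. -/
lemma IsAdicComplete.exists_powerSeries_eval {a : A} (ha : a ∈ I) :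
    ∃ t : (ℕ → A) → A, ∀ ε m, t ε = ∑ i ∈ Finset.range m, ε i * a ^ i +
      a ^ m * t (fun i ↦ ε (m + i)) := by
  have hex (ε : ℕ → A) : ∃ L : A, ∀ n, ∑ i ∈ Finset.range n, ε i * a ^ i - L ∈ I ^ n := by
    obtain ⟨L, hL⟩ := IsPrecomplete.prec' (I := I) (M := A)
      (fun n ↦ ∑ i ∈ Finset.range n, ε i * a ^ i) (by
        intro m n hmn
        rw [SModEq.comm, SModEq.sub_mem, ← Finset.sum_Ico_eq_sub _ hmn]
        refine Submodule.sum_mem _ fun i hi ↦ ?_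
        rw [smul_eq_mul, Ideal.mul_top]
        exact Ideal.mul_mem_left _ _ (Ideal.pow_le_pow_right (Finset.mem_Ico.mp hi).1
          (Ideal.pow_mem_pow ha i)))
    refine ⟨L, fun n ↦ ?_⟩
    simpa [SModEq.sub_mem] using hL n
  choose t ht using hex
  refine ⟨t, fun ε m ↦ ?_⟩
  refine sub_eq_zero.mp (IsHausdorff.haus' (I := I) _ fun n ↦ ?_)
  rw [SModEq.zero, smul_eq_mul, Ideal.mul_top]
  have h1 := Ideal.pow_le_pow_right (Nat.le_add_left n m) (ht ε (m + n))
  have h2 := Ideal.mul_mem_left _ (a ^ m) (ht (fun i ↦ ε (m + i)) n)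
  have h3 := (I ^ n).sub_mem h2 h1
  convert h3 using 1
  rw [Finset.sum_range_add, mul_sub, Finset.mul_sum]
  have : ∑ i ∈ Finset.range n, a ^ m * (ε (m + i) * a ^ i) =
      ∑ i ∈ Finset.range n, ε (m + i) * a ^ (m + i) :=
    Finset.sum_congr rfl fun i _ ↦ by ring
  rw [this]
  ring

/-- If `n` is the first index where two sequences differ, the difference of the series is `a ^ n`
times a unit plus a multiple of `a`; that sum is a unit because `a` is in the Jacobson radical. -/
lemma IsAdicComplete.exists_family_sub_dvd_pow {a : A} (ha : a ∈ I) {k : Type*} (τ : k → A)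
    (hτ : ∀ c d, c ≠ d → IsUnit (τ c - τ d)) :
    ∃ t : (ℕ → k) → A, ∀ ε δ, ε ≠ δ → ∃ n, t ε - t δ ∣ a ^ n := by
  obtain ⟨t, ht⟩ := IsAdicComplete.exists_powerSeries_eval I ha
  refine ⟨fun ε ↦ t (τ ∘ ε), fun ε δ hne ↦ ?_⟩
  classical
  have hex : ∃ n, ε n ≠ δ n := Function.ne_iff.mp hne
  let n := Nat.find hex
  have hn : ε n ≠ δ n := Nat.find_spec hex
  have hlt (i) (hi : i < n) : ε i = δ i := not_not.mp (Nat.find_min hex hi)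
  refine ⟨n, ?_⟩
  dsimp only
  rw [ht (τ ∘ ε) n, ht (τ ∘ δ) n, ht (fun i ↦ (τ ∘ ε) (n + i)) 1,
    ht (fun i ↦ (τ ∘ δ) (n + i)) 1,
    Finset.sum_congr rfl fun i hi ↦ by
      rw [Function.comp_apply, hlt i (Finset.mem_range.mp hi), ← Function.comp_apply (f := τ)]]
  generalize t _ = u
  generalize t _ = v
  have hunit : IsUnit (τ (ε n) - τ (δ n) + a * (u - v)) := by
    obtain ⟨w, hw⟩ := hτ _ _ hn
    have := Ideal.mem_jacobson_bot.mp (IsAdicComplete.le_jacobson_bot I ha) (↑w⁻¹ * (u - v))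
    have h2 := w.isUnit.mul this
    convert h2 using 1
    rw [← hw]
    linear_combination (-a * (u - v)) * w.mul_inv
  obtain ⟨w, hw⟩ := hunit
  refine ⟨↑w⁻¹, ?_⟩
  have : a ^ n = a ^ n * (τ (ε n) - τ (δ n) + a * (u - v)) * ↑w⁻¹ := by
    rw [← hw, mul_assoc, w.mul_inv, mul_one]
  refine this.trans (congrArg (· * _) ?_)
  simp
  ring

end

/-! ### Cardinality bounds for `T` and its spectrum -/

lemma Cardinal.mk_nat_arrow_power_aleph0 (k : Type u) : #(ℕ → k) ^ ℵ₀ = #(ℕ → k) := by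
  simp [← power_mul]

lemma Cardinal.aleph0_le_mk_nat_arrow (k : Type u) [Nontrivial k] : ℵ₀ ≤ #(ℕ → k) := by
  have : Infinite (ℕ → k) := inferInstance
  exact aleph0_le_mk _

section

variable {R : Type u} [CommRing R] [IsLocalRing R] [IsNoetherianRing R]

/-- Each layer `M ^ n / M ^ (n + 1)` is finite-dimensional over `k`. Bounding by `k^ℕ` instead of
`k` treats finite and infinite `k` alike. -/
lemma IsLocalRing.mk_quotient_maximalIdeal_pow_le (n : ℕ) :
    #(R ⧸ maximalIdeal R ^ n) ≤ #(ℕ → ResidueField R) := by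
  have hinf := aleph0_le_mk_nat_arrow (ResidueField R)
  induction n with
  | zero =>
    have : Subsingleton (R ⧸ maximalIdeal R ^ 0) := Ideal.Quotient.subsingleton_iff.mpr (by simp)
    exact (le_one_iff_subsingleton.mpr this).trans (one_le_aleph0.trans hinf)
  | succ n ih =>
    obtain ⟨g, b, hb⟩ := Submodule.fg_iff_exists_fin_generating_family.mp
      (IsNoetherian.noetherian (maximalIdeal R ^ n))
    let F : (R ⧸ maximalIdeal R ^ n) × (Fin g → ResidueField R) → R ⧸ maximalIdeal R ^ (n + 1) :=
      fun z ↦ Ideal.Quotient.mk _ (z.1.out + ∑ j, (z.2 j).out * b j)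
    have hF : Function.Surjective F := by
      intro y
      obtain ⟨r, rfl⟩ := Ideal.Quotient.mk_surjective y
      let x : R ⧸ maximalIdeal R ^ n := Ideal.Quotient.mk _ r
      have hx : r - x.out ∈ maximalIdeal R ^ n := by
        rw [← Ideal.Quotient.mk_eq_mk_iff_sub_mem]
        exact (Quotient.out_eq x).symm
      obtain ⟨c, hc⟩ := (Submodule.mem_span_range_iff_exists_fun R).mp (hb.ge hx)
      refine ⟨(x, fun j ↦ residue R (c j)), ?_⟩
      rw [eq_comm, Ideal.Quotient.mk_eq_mk_iff_sub_mem]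
      have : r - (x.out + ∑ j, (residue R (c j)).out * b j) =
          ∑ j, (c j - (residue R (c j)).out) * b j := by
        simp only [sub_mul, Finset.sum_sub_distrib]
        simp only [smul_eq_mul] at hc
        rw [hc]
        ring
      dsimp only
      rw [this, pow_succ']
      refine Ideal.sum_mem _ fun j _ ↦ Ideal.mul_mem_mul ?_ ?_
      · rw [← Ideal.Quotient.mk_eq_mk_iff_sub_mem]
        exact (Quotient.out_eq (residue R (c j))).symm
      · rw [← hb]
        exact Submodule.subset_span ⟨j, rfl⟩
    refine (mk_le_of_surjective hF).trans ?_
    rw [mk_prod, lift_id, lift_id]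
    refine mul_le_of_le hinf ih ?_
    let p : (ℕ → ResidueField R) → (Fin g → ResidueField R) := fun f i ↦ f i
    refine mk_le_of_surjective (f := p) fun f ↦ ⟨fun i ↦ if h : i < g then f ⟨i, h⟩ else 0, ?_⟩
    ext i
    simp [p]

lemma IsLocalRing.mk_adicCompletion_le :
    #(AdicCompletion (maximalIdeal R) R) ≤ #(ℕ → ResidueField R) := by
  have hinj : Function.Injective (fun (x : AdicCompletion (maximalIdeal R) R) (n : ℕ) ↦
      AdicCompletion.evalₐ (maximalIdeal R) n x) :=
    fun x y h ↦ AdicCompletion.ext_evalₐ fun n ↦ congrFun h n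
  refine (mk_le_of_injective hinj).trans ?_
  rw [mk_pi, ← mk_nat_arrow_power_aleph0]
  refine (prod_le_prod _ _ fun n ↦ mk_quotient_maximalIdeal_pow_le n).trans ?_
  rw [prod_const]
  simp

end

/-- A prime is determined by a finite generating set. -/
lemma PrimeSpectrum.mk_le_of_isNoetherianRing (A : Type u) [CommRing A] [IsNoetherianRing A] :
    #(PrimeSpectrum A) ≤ max #A ℵ₀ := by
  have hsurj : ∀ p : PrimeSpectrum A, ∃ s : Finset A, Ideal.span (s : Set A) = p.asIdeal :=
    fun p ↦ IsNoetherian.noetherian p.asIdeal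
  choose s hs using hsurj
  have hinj : Function.Injective s := fun p q h ↦ PrimeSpectrum.ext (by rw [← hs, h, hs])
  refine (mk_le_of_injective hinj).trans ?_
  cases finite_or_infinite A
  · exact (lt_aleph0_of_finite _).le.trans (le_max_right _ _)
  · rw [mk_finset_of_infinite]
    exact le_max_left _ _

lemma IsLocalRing.mk_primeSpectrum_adicCompletion_le (R : Type u) [CommRing R] [IsLocalRing R]
    [IsNoetherianRing R] :
    #(PrimeSpectrum (AdicCompletion (maximalIdeal R) R)) ≤ #(ℕ → ResidueField R) := by
  have := AdicCompletion.isNoetherianRing (maximalIdeal R)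
  exact (PrimeSpectrum.mk_le_of_isNoetherianRing _).trans
    (max_le mk_adicCompletion_le (aleph0_le_mk_nat_arrow _))

/-- Let `R` be a local ring with residue field `k` and `S` a Noetherian `R`-algebra that is
`J`-adically complete. If `Q₁ < Q₂ < Q₃` are primes of `S` with `J` not contained in `Q₁`, then
there are at least `#(ℕ → k)` primes strictly between `Q₁` and `Q₃`. -/
lemma IsAdicComplete.mk_nat_arrow_residueField_le {R S : Type u} [CommRing R] [IsLocalRing R]
    [CommRing S] [IsNoetherianRing S] [Algebra R S] (J : Ideal S) [IsAdicComplete J S]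
    {Q₁ Q₂ Q₃ : PrimeSpectrum S} (h₁₂ : Q₁ < Q₂) (h₂₃ : Q₂ < Q₃) (hJ : ¬ J ≤ Q₁.asIdeal) :
    #(ℕ → ResidueField R) ≤ #{Q : PrimeSpectrum S // Q₁ < Q ∧ Q < Q₃} := by
  obtain ⟨a, haJ, ha⟩ := SetLike.not_le_iff_exists.mp hJ
  choose τ hτ using residue_surjective (R := R)
  obtain ⟨t, ht⟩ := IsAdicComplete.exists_family_sub_dvd_pow J haJ
    (fun c ↦ algebraMap R S (τ c)) (by
      intro c d hcd
      rw [← map_sub]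
      refine IsUnit.map _ ?_
      rw [← residue_ne_zero_iff_isUnit, map_sub, hτ, hτ]
      exact sub_ne_zero.mpr hcd)
  obtain ⟨f, hf⟩ := Ideal.exists_injective_primeSpectrum_between h₁₂ h₂₃ ha t ht
  exact mk_le_of_injective hf

/-! ### The main theorem -/

theorem theorem4p9 {R : Type u} [CommRing R] [IsLocalRing R] [IsNoetherianRing R]
    (hdim : 2 ≤ ringKrullDim R)
    (n : ℕ) (hn : 1 ≤ n) (P : Fin n → Ideal R) (hP : ∀ i, (P i).IsPrime)
    (hinc : ∀ i j, i ≠ j → ¬ P i ≤ P j) :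
    ∃ (S : Type u) (_ : CommRing S) (_ : Algebra R S) (_ : IsLocalRing S),
      IsNoetherianRing S ∧
      -- `S` is a completion of `R` at the intersection of the primes `P i`
      Nonempty (S ≃ₐ[R] AdicCompletion (⨅ i, P i) R) ∧
      -- `S` is a faithfully flat local extension ring of `R`
      Function.Injective (algebraMap R S) ∧
      Module.FaithfullyFlat R S ∧
      IsLocalHom (algebraMap R S) ∧
      -- `R` and `S` have the same completion `T` at their maximal ideals
      Nonempty (AdicCompletion (IsLocalRing.maximalIdeal S) S ≃ₐ[R]
        AdicCompletion (IsLocalRing.maximalIdeal R) R) ∧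
      (∀ i, Nonempty ((S ⧸ (P i).map (algebraMap R S)) ≃ₐ[R] (R ⧸ P i))) ∧
      (∀ Q₁ Q₂ Q₃ : PrimeSpectrum S, Q₁ < Q₂ → Q₂ < Q₃ →
        (∀ i, ¬ (P i).map (algebraMap R S) ≤ Q₁.asIdeal) →
        Cardinal.mk {Q : PrimeSpectrum S // Q₁ < Q ∧ Q < Q₃} =
          Cardinal.mk (PrimeSpectrum (AdicCompletion (IsLocalRing.maximalIdeal R) R))) ∧
      (∀ i,
        Cardinal.mk (PrimeSpectrum (R ⧸ P i)) <
          Cardinal.mk (PrimeSpectrum (AdicCompletion (IsLocalRing.maximalIdeal R) R)) →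
        Cardinal.mk (PrimeSpectrum (S ⧸ (P i).map (algebraMap R S))) <
          Cardinal.mk (PrimeSpectrum (AdicCompletion (IsLocalRing.maximalIdeal R) R))) := by

  have hIM : (⨅ i, P i) ≠ ⊤ := by
    intro h
    have := iInf_le P ⟨0, hn⟩
    rw [h, top_le_iff] at this
    exact (hP _).ne_top this
  have hprime (Q : Ideal R) (hQ : Q.IsPrime) (h : ⨅ i, P i ≤ Q) : ∃ i, P i ≤ Q := by
    rw [← Finset.inf_univ_eq_iInf, hQ.inf_le'] at h
    simpa using h
  generalize hI' : (⨅ i, P i) = I at hIM hprime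
  have hIP (i) : I ≤ P i := hI' ▸ iInf_le P i
  have hIfg : I.FG := IsNoetherian.noetherian I
  let S := AdicCompletion I R
  have hloc : IsLocalRing S := AdicCompletion.isLocalRing_of_ne_top I hIfg hIM
  have hnoeth : IsNoetherianRing S := AdicCompletion.isNoetherianRing I
  have hff : Module.FaithfullyFlat R S := AdicCompletion.faithfullyFlat_of_ne_top I hIM
  have hmax : maximalIdeal S = (maximalIdeal R).map (algebraMap R S) :=
    AdicCompletion.maximalIdeal_eq_map_of_ne_top I hIfg hIM
  have hcomplete := AdicCompletion.isAdicComplete_self I hIfg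
  have hpow (n : ℕ) (s : S) : ∃ r : R, s - algebraMap R S r ∈ maximalIdeal S ^ n := by
    obtain ⟨r, hr⟩ := AdicCompletion.exists_sub_algebraMap_mem I hIfg n s
    refine ⟨r, ?_⟩
    rw [hmax, ← Ideal.map_pow]
    exact Ideal.map_mono (Ideal.pow_right_mono (le_maximalIdeal hIM) n) hr
  let eT : AdicCompletion (maximalIdeal S) S ≃ₐ[R] AdicCompletion (maximalIdeal R) R :=
    AdicCompletion.congrOfQuotientEquiv (maximalIdeal R) (maximalIdeal S)
      (fun n ↦ Ideal.quotientEquivOfFaithfullyFlat _ _ (by rw [hmax, Ideal.map_pow]) (hpow n)) hpow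
  have eP (i) : Nonempty ((S ⧸ (P i).map (algebraMap R S)) ≃ₐ[R] (R ⧸ P i)) :=
    ⟨(Ideal.quotientEquivOfFaithfullyFlat (P i) _ rfl fun s ↦ by
      obtain ⟨r, hr⟩ := AdicCompletion.exists_sub_algebraMap_mem I hIfg 1 s
      rw [pow_one] at hr
      exact ⟨r, Ideal.map_mono (hIP i) hr⟩).symm⟩
  refine ⟨S, inferInstance, inferInstance, hloc, hnoeth, ⟨AlgEquiv.refl⟩,
    FaithfulSMul.algebraMap_injective R S, hff, AdicCompletion.isLocalHom_algebraMap I hIM, ⟨eT⟩,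
    eP, fun Q₁ Q₂ Q₃ h₁₂ h₂₃ hQ₁ ↦ le_antisymm ?_ ?_, fun i hi ↦ ?_⟩
  · have : Module.FaithfullyFlat S (AdicCompletion (maximalIdeal S) S) :=
      AdicCompletion.faithfullyFlat_of_ne_top _ (Ideal.IsPrime.ne_top inferInstance)
    refine (mk_subtype_le _).trans ?_
    refine (mk_le_of_surjective (PrimeSpectrum.comap_surjective_of_faithfullyFlat
      (A := S) (B := AdicCompletion (maximalIdeal S) S))).trans_eq ?_
    exact mk_congr (PrimeSpectrum.comapEquiv eT.toRingEquiv).toEquiv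
  -- If `IS ≤ Q₁`, the contraction of `Q₁` to `R` contains the intersection of the `P i`, hence some
  -- `P i`, which is excluded.
  · refine (mk_primeSpectrum_adicCompletion_le R).trans
      (IsAdicComplete.mk_nat_arrow_residueField_le (I.map (algebraMap R S)) h₁₂ h₂₃ fun hle ↦ ?_)
    obtain ⟨i, hi⟩ := hprime _ inferInstance (Ideal.map_le_iff_le_comap.mp hle)
    exact hQ₁ i (Ideal.map_le_iff_le_comap.mpr hi)
  · obtain ⟨e⟩ := eP i
    exact (mk_congr (PrimeSpectrum.comapEquiv e.toRingEquiv).toEquiv).trans_lt hi
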